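/- \textbf{Conventions.} Graphs are finite and are considered up to isomorphism; $\mathbb N=\{1,2,\dots\}$; $K$ is a field of characteristic $0$ (e.g. $\mathbb R$). A weighted graph has a symmetric adjacency matrix $(a_{x,y})$ over $K$, and for a multigraph $G$ (loops and parallel edges allowed) $\hom(G,H)=\sum_{f:V(G)\to V(H)}\prod_{uv\in E(G)}a_{f(u),f(v)}$. A sequence $(H_{\mathbf k})_{\mathbf k\in\mathbb N^{n}}$ of weighted graphs is \emph{strongly polynomial} if for every multigraph $G$ there is a polynomial $p_G$ over $K$ with $\hom(G,H_{\mathbf k})=p_G(\mathbf k)$ for all $\mathbf k\in\mathbb N^n$. A sequence indexed by $I\subseteq\mathbb N^n$ is a \emph{strongly polynomial subsequence} if it is the restriction to $I$ of a strongly polynomial sequence indexed by $\mathbb N^n$. \textbf{Ornaments and composition.} Given graphs $F_v$ $(v\in V(H))$, the composition $H[\{F_v\}]$ of a simple graph $H$ is the disjoint union of the $F_v$ together with all edges (of weight $1$) between $F_u$ and $F_v$ for each $uv\in E(H)$. An ornamented graph $H\langle\{F_s\}\rangle$ is a non-empty simple graph $H$ with a graph sequence $F_s=(F_{s;\mathbf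 j})_{\mathbf j}$ assigned to each vertex $s$. Isomorphisms of ornamented graphs preserve ornaments. \textbf{Trees and branching.} Let $T$ be a rooted tree, $P(s)$ the set of vertices on the path from the root to $s$, $B(s)$ the subtree rooted at $s$, and $\mathrm{clos}(T)$ the graph on $V(T)$ in which two distinct vertices are adjacent iff one of them is an ancestor of the other. A spanning subgraph $G\subseteq\mathrm{clos}(T)$ with ornaments $F_s$ is encoded by colouring each $s\in V(T)$ by $(A_s,F_s)$, where $A_s$ is the set of levels of those vertices of $P(s)$ that are adjacent to $s$ in $G$. For $\mathbf k\in\mathbb N^{V(T)}$, the graph $T^{\mathbf k}(G)$ has as vertices the pairs $(s,c)$ with $s\in V(T)$ and $c\in\prod_{t\in P(s)}\{1,\dots,k_t\}$ (the copies of $s$); $(s,c)$ and $(t,d)$ are adjacent iff $st\in E(G)$ and $c,d$ agree on $P(s)\cap P(t)$. Each copy of $s$ carries the ornament $F_s$. \textbf{Branching core.} Start with a coloured rooted tree $T$ and multiplicity $1$ at every vertex. As long as there are distinct vertices $s,t$ with the same parent such that $B(s)$ and $B(t)$ are isomorphic as rooted trees, preserving colours and multiplicities except possibly the multiplicities of the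 roots $s,t$, delete $B(t)$ and add the multiplicity of $t$ to that of $s$. The tree with which this ends is the branching core of $T$, and $\mathrm{bc}(T)$ is its number of vertices. The minimum branching core size $\underline{\mathrm{bc}}(H\langle\{F_s\}\rangle)$ is the minimum of $\mathrm{bc}(T)$ over all coloured rooted trees $T$ on $V(H)$ with $H\subseteq\mathrm{clos}(T)$ that encode $H\langle\{F_s\}\rangle$. \textbf{Statement.} Let $\mathcal F$ be a finite set of strongly polynomial sequences of weighted graphs, each indexed by $\mathbf j\in\mathbb N^h$, and let $\mathcal H$ be a family of ornamented graphs all of whose ornaments belong to $\mathcal F$. Suppose that $\{\underline{\mathrm{bc}}(X):X\in\mathcal H\}$ is bounded. Then there is a partition of $\mathcal H$ into finitely many non-empty subfamilies $\mathcal H_1,\dots,\mathcal H_m$, with isomorphic members lying in the same subfamily, and for each $\ell$ there are a rooted tree $T_\ell$, a fixed graph $G_\ell\subseteq\mathrm{clos}(T_\ell)$ with $V(G_\ell)=V(T_\ell)$, fixed ornaments $F_s=(F_{s;\mathbf j})_{\mathbf j}\in\mathcal F$ $(s\in V(T_\ell))$ and a set $I_\ell\subseteq\mathbb N^{V(T_\ell)}$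 such that, for each $\ell$, the following hold. (i) The family $\mathcal H_\ell$ is indexed by $I_\ell$: each member of $\mathcal H_\ell$ is isomorphic, as an ornamented graph, to $T_\ell^{\mathbf k}(G_\ell)\langle\{F_s\}\rangle$ for exactly one $\mathbf k\in I_\ell$, and each $\mathbf k\in I_\ell$ arises in this way. If $X\in\mathcal H_\ell$ has index $\mathbf k$, then for every $\mathbf j\in\mathbb N^h$ the composition of $X$ at $\mathbf j$ is isomorphic to $H_{\mathbf k,\mathbf j}:=T_\ell^{\mathbf k}(G_\ell)[\{F_{s;\mathbf j}\}]$. (ii) $(H_{\mathbf k,\mathbf j}:\mathbf k\in I_\ell,\ \mathbf j\in\mathbb N^h)$ is a strongly polynomial subsequence, indexed by $I_\ell\times\mathbb N^h\subseteq\mathbb N^{V(T_\ell)}\times\mathbb N^h$. (iii) For each fixed $\mathbf j\in\mathbb N^h$, $(H_{\mathbf k,\mathbf j}:\mathbf k\in I_\ell)$ is a strongly polynomial subsequence indexed by $I_\ell\subseteq\mathbb N^{V(T_\ell)}$. -/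

import Mathlib

/-- A finite edge-weighted graph with weights in `K`, given by its symmetric adjacency matrix
(`w x x` is the weight of the loop at `x`). Simple graphs and multigraphs are the cases of
`{0,1}`-valued and natural-number valued weights. -/
structure WGraph (K : Type*) where
  V : Type
  finite : Finite V
  w : V → V → K
  symm : ∀ x y, w x y = w y x

attribute [instance] WGraph.finite

/-- Isomorphism of weighted graphs. -/
def WGraph.Iso {K : Type*} (A B : WGraph K) : Prop :=
  ∃ e : A.V ≃ B.V, ∀ x y, B.w (e x) (e y) = A.w x y

/-- The homomorphism number `hom(G, H)` of a finite multigraph `G` (loops and parallel edges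
allowed) with vertex set `V`, edge set `E` and end points `ends e` of the edge `e`. The order in
which the two ends of an edge are listed is immaterial because the weights of `H` are symmetric. -/
noncomputable def homNumber {K : Type*} [CommSemiring K] {V E : Type} [Fintype V] [Fintype E]
    (ends : E → V × V) (H : WGraph K) : K :=
  ∑ᶠ f : V → H.V, ∏ e : E, H.w (f (ends e).1) (f (ends e).2)

/-- A sequence of weighted graphs indexed by all tuples of positive integers (with index set `σ`
for the coordinates of the tuples) is strongly polynomial if every homomorphism number
`hom(G, ·)` is given by one polynomial. -/
def IsStronglyPolynomial {K : Type*} [CommSemiring K] {σ : Type*}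
    (H : (σ → ℕ+) → WGraph K) : Prop :=
  ∀ (V E : Type) [Fintype V] [Fintype E] (ends : E → V × V),
    ∃ p : MvPolynomial σ K, ∀ k : σ → ℕ+,
      homNumber ends (H k) = MvPolynomial.eval (fun i => ((k i : ℕ) : K)) p

/-- `(H k : k ∈ I)` is a subsequence of a strongly polynomial sequence
(graphs being identified when isomorphic). -/
def IsStronglyPolynomialSubseq {K : Type*} [CommSemiring K] {σ : Type*}
    (I : Set (σ → ℕ+)) (H : (σ → ℕ+) → WGraph K) : Prop :=
  ∃ H' : (σ → ℕ+) → WGraph K, IsStronglyPolynomial H' ∧ ∀ k ∈ I, (H' k).Iso (H k)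

/-- Graph sequences indexed by `h`-tuples of positive integers. -/
abbrev GraphSeq (K : Type*) (h : ℕ) := (Fin h → ℕ+) → WGraph K

/-- Termwise isomorphism of graph sequences. -/
def GraphSeq.Iso {K : Type*} {h : ℕ} (F F' : GraphSeq K h) : Prop :=
  ∀ j, (F j).Iso (F' j)

/-- A (non-empty, finite) simple graph each of whose vertices is ornamented with a
graph sequence. -/
structure OrnamentedGraph (K : Type*) (h : ℕ) where
  V : Type
  finite : Finite V
  nonempty : Nonempty V
  graph : SimpleGraph V
  orn : V → GraphSeq K h

attribute [instance] OrnamentedGraph.finite OrnamentedGraph.nonempty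

/-- Isomorphism of ornamented graphs. -/
def OrnamentedGraph.Iso {K : Type*} {h : ℕ} (X Y : OrnamentedGraph K h) : Prop :=
  ∃ e : X.graph ≃g Y.graph, ∀ v, GraphSeq.Iso (X.orn v) (Y.orn (e v))

open Classical in
/-- The composition `H[{F_v}]`: the disjoint union of the graphs `F v`, with all edges (of
weight `1`) between `F u` and `F v` added whenever `u` and `v` are adjacent in `H`. -/
noncomputable def composition {K : Type*} [CommSemiring K] {V : Type} [Finite V]
    (H : SimpleGraph V) (F : V → WGraph K) : WGraph K where
  V := Σ v, (F v).V
  finite := inferInstance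
  w x y := if e : x.1 = y.1 then (F y.1).w (e ▸ x.2) y.2 else if H.Adj x.1 y.1 then 1 else 0
  symm := by
    rintro ⟨u, x⟩ ⟨v, y⟩
    by_cases e : u = v
    · subst e
      simpa using (F u).symm x y
    · have e' : ¬ v = u := fun h => e h.symm
      simp [e, e', H.adj_comm]

/-- The composition `H[{F_{s;j}}]` of an ornamented graph, at the index `j`. -/
noncomputable def OrnamentedGraph.comp {K : Type*} [CommSemiring K] {h : ℕ}
    (X : OrnamentedGraph K h) (j : Fin h → ℕ+) : WGraph K :=
  composition X.graph fun v => X.orn v j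

/-- The closure of a rooted tree. The order is the ancestor order: `s ≤ t` iff `s` lies on the
path `P(t)` from the root `⊥` to `t`, so that `P(t) = Set.Iic t`, the subtree `B(s)` rooted at `s`
is `Set.Ici s`, and the parent of `s ≠ ⊥` is `Order.pred s`. -/
def treeClosure (T : RootedTree.{0}) : SimpleGraph T :=
  SimpleGraph.fromRel fun s t => s ≤ t

/-- The level of a vertex of a rooted tree, i.e. the number of its (proper) ancestors. -/
noncomputable def treeLevel {T : RootedTree.{0}} (s : T) : ℕ := (Set.Iio s).ncard

/-- A finite rooted tree together with a spanning subgraph of its closure and an ornament on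
each vertex; equivalently, the vertex `s` is coloured by the pair `(A_s, F_s)`, where `A_s` is
`ColouredTree.levels` below. -/
structure ColouredTree (K : Type*) (h : ℕ) where
  tree : RootedTree.{0}
  finite : Finite tree
  graph : SimpleGraph tree
  graph_le : graph ≤ treeClosure tree
  orn : tree → GraphSeq K h

attribute [instance] ColouredTree.finite

namespace ColouredTree

variable {K : Type*} {h : ℕ} (T : ColouredTree K h)

/-- The first colour component `A_s`: the set of levels of those vertices on the path from the
root to `s` that are adjacent to `s` in the encoded graph. -/
def levels (s : T.tree) : Set ℕ := {i | ∃ t, t ≤ s ∧ T.graph.Adj s t ∧ treeLevel t = i}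

/-- The ornamented graph encoded by a coloured rooted tree. -/
def toOrnamentedGraph : OrnamentedGraph K h where
  V := T.tree
  finite := T.finite
  nonempty := ⟨⊥⟩
  graph := T.graph
  orn := T.orn

/-- The copies of the vertices of `T` in the `k`-branching of `T`: a copy of `s` is given by the
choice of one of the `k t` branches at each vertex `t` on the path from the root to `s`, so that
there are `∏_{t ∈ P(s)} k t` of them. -/
abbrev Copy (k : T.tree → ℕ+) : Type :=
  Σ s : T.tree, (∀ t : Set.Iic s, Fin (k t))

/-- The ornamented graph obtained from the `k`-branching of `T`. A copy of `s` is an ancestor or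
descendant of a copy of `t` iff `s` and `t` are comparable and the choices of branches agree
at all common ancestors; it is then joined to it iff `s` and `t` are adjacent in the graph encoded
by `T`. All copies of `s` carry the ornament of `s`. -/
def branch (k : T.tree → ℕ+) : OrnamentedGraph K h where
  V := T.Copy k
  finite := inferInstance
  nonempty := ⟨⟨⊥, fun t => ⟨0, (k t).pos⟩⟩⟩
  graph :=
    { Adj := fun x y => T.graph.Adj x.1 y.1 ∧
        ∀ (u : T.tree) (hx : u ≤ x.1) (hy : u ≤ y.1), (x.2 ⟨u, hx⟩ : ℕ) = y.2 ⟨u, hy⟩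
      symm := ⟨fun _ _ hxy => ⟨hxy.1.symm, fun u hx hy => (hxy.2 u hy hx).symm⟩⟩
      loopless := ⟨fun x hx => T.graph.loopless.irrefl x.1 hx.1⟩ }
  orn x := T.orn x.1

/-- A stage of the reduction of `T` to its branching core: the set of the vertices that have not
been deleted, and the branching multiplicities (relevant on those vertices only). -/
abbrev Stage : Type := Set T.tree × (T.tree → ℕ+)

/-- At the stage `c` the subtrees rooted at `s` and `t` are isomorphic, including all three colour
components, except possibly for the branching multiplicities of their roots. -/
def BranchesIso (c : T.Stage) (s t : T.tree) : Prop :=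
  ∃ φ : {x // x ∈ c.1 ∧ s ≤ x} ≃o {x // x ∈ c.1 ∧ t ≤ x}, ∀ x,
    T.levels x.1 = T.levels (φ x).1 ∧ GraphSeq.Iso (T.orn x.1) (T.orn (φ x).1) ∧
      (x.1 ≠ s → c.2 x.1 = c.2 (φ x).1)

open Classical in
/-- One elimination step: `s` and `t` are distinct siblings whose subtrees are isomorphic; the
subtree rooted at `t` is deleted, and its multiplicity is added to that of `s`. (Eliminating
several isomorphic subtrees at once amounts to several such steps.) -/
def Step (c c' : T.Stage) : Prop :=
  ∃ s t : T.tree, s ∈ c.1 ∧ t ∈ c.1 ∧ s ≠ t ∧ s ≠ ⊥ ∧ t ≠ ⊥ ∧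
    Order.pred s = Order.pred t ∧ T.BranchesIso c s t ∧
    c' = (c.1 \ Set.Ici t, Function.update c.2 s (c.2 s + c.2 t))

/-- `c` is the branching core of `T`: it is reached from `T` with all multiplicities `1`, and no
further elimination is possible. -/
def IsBranchingCore (c : T.Stage) : Prop :=
  Relation.ReflTransGen T.Step (Set.univ, fun _ => 1) c ∧ ∀ c', ¬ T.Step c c'

/-- The branching core size `bc(T)`. -/
noncomputable def bc : ℕ := sInf {n | ∃ c, T.IsBranchingCore c ∧ c.1.ncard = n}

end ColouredTree

/-- The minimum branching core size of an ornamented graph: the minimum of `bc(T)` over all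
coloured rooted trees `T` that encode it. -/
noncomputable def OrnamentedGraph.minBC {K : Type*} {h : ℕ} (X : OrnamentedGraph K h) : ℕ :=
  sInf {n | ∃ T : ColouredTree K h, T.toOrnamentedGraph.Iso X ∧ T.bc = n}

/-! ### Counting functions with a prescribed kernel -/

section Polynomiality

/-! Two facts carry the proof: branchings of a fixed coloured tree give polynomial homomorphism
numbers, and bounded minimum branching core size leaves only finitely many coloured trees to branch.

Polynomiality (`isStronglyPolynomial_comp_branch`): a map into a composition of a branching chooses,
for each vertex of the source, a tree vertex, a branch at each ancestor, and a point of the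
ornament. The product of weights sees the branches only through the pattern of coincidences among
them. For a fixed placement and pattern, the number of branch choices is a product of falling
factorials in the `k t`, and the sum over ornament points is a product of homomorphism numbers of
the ornaments, hence polynomial in `j`.

Finiteness (`exists_finite_trees`): each elimination step preserves the encoded graph, provided that
multiplicities are read as numbers of branches: the copies in the deleted branch become the last
copies of the retained one (`Represents.mergeStage`). Thus every ornamented graph is a branching of
its core. A core with at most `N` vertices and ornaments from a finite set has finitely many
isomorphism types. Choosing a tree and an index for each isomorphism class gives the partition. -/

theorem exists_polynomial_card_ker (K : Type*) [CommRing K] {U : Type*} [Finite U]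
    (r : U → U → Prop) :
    ∃ q : Polynomial K, ∀ n : ℕ,
      (Nat.card {α : U → Fin n // ∀ u v, α u = α v ↔ r u v} : K) = q.eval (n : K) := by
  classical
  by_cases hr : Equivalence r
  · let S : Setoid U := ⟨r, hr⟩
    have := Fintype.ofFinite (Quotient S)
    -- Functions with kernel `r` are the injections of the set of classes, counted by a falling
    -- factorial.
    refine ⟨descPochhammer K (Fintype.card (Quotient S)), fun n => ?_⟩
    rw [descPochhammer_eval_eq_descFactorial]
    have key : {α : U → Fin n // ∀ u v, α u = α v ↔ r u v} ≃ (Quotient S ↪ Fin n) :=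
      { toFun := fun α => ⟨Quotient.lift α.1 fun u v huv => (α.2 u v).2 huv, by
          rintro ⟨u⟩ ⟨v⟩ huv
          exact Quotient.sound ((α.2 u v).1 huv)⟩
        invFun := fun β => ⟨fun u => β (Quotient.mk S u), fun u v => by
          rw [β.injective.eq_iff]
          exact Quotient.eq (r := S)⟩
        left_inv := fun α => rfl
        right_inv := fun β => by
          ext ⟨u⟩
          rfl }
    rw [Nat.card_congr key, Nat.card_eq_fintype_card, Fintype.card_embedding_eq, Fintype.card_fin]
  · refine ⟨0, fun n => ?_⟩
    have : IsEmpty {α : U → Fin n // ∀ u v, α u = α v ↔ r u v} := ⟨fun α => hr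
      ⟨fun u => (α.2 u u).1 rfl, fun {u v} huv => (α.2 v u).1 ((α.2 u v).2 huv).symm,
        fun {u v w} huv hvw => (α.2 u w).1 (((α.2 u v).2 huv).trans ((α.2 v w).2 hvw))⟩⟩
    simp

/-- The pattern of coincidences between the branches chosen for the vertices `v` of a graph that
are placed at the vertices `σ v` of a tree. -/
def branchPattern {V τ : Type*} [Preorder τ] {σ : V → τ} {k : τ → ℕ+}
    (a : ∀ v, ∀ t : Set.Iic (σ v), Fin (k t)) (t : τ) (u v : V) : Prop :=
  ∃ (hu : t ≤ σ u) (hv : t ≤ σ v), a u ⟨t, hu⟩ = a v ⟨t, hv⟩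

/-- The conditions at different tree vertices are independent: at `t`, the choices of all `v` placed
above `t` form a function into `Fin (k t)` with prescribed kernel. The count is therefore a product
of polynomials in one variable each. A pattern relating vertices not both placed above `t` never
occurs. -/
theorem exists_mvPolynomial_card_branchPattern (K : Type*) [CommRing K] {V τ : Type*} [Finite V]
    [Finite τ] [Preorder τ] (σ : V → τ) (r : τ → V → V → Prop) :
    ∃ q : MvPolynomial τ K, ∀ k : τ → ℕ+,
      (Nat.card {a : ∀ v, ∀ t : Set.Iic (σ v), Fin (k t) // branchPattern a = r} : K) =
        MvPolynomial.eval (fun i => ((k i : ℕ) : K)) q := by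
  classical
  have := Fintype.ofFinite τ
  by_cases hr : ∀ t u v, r t u v → t ≤ σ u ∧ t ≤ σ v
  · choose q hq using fun t => exists_polynomial_card_ker K
      fun u v : {v // t ≤ σ v} => r t u.1 v.1
    refine ⟨∏ t, (q t).toMvPolynomial t, fun k => ?_⟩
    have key : {a : ∀ v, ∀ t : Set.Iic (σ v), Fin (k t) // branchPattern a = r} ≃
        ∀ t, {α : {v // t ≤ σ v} → Fin (k t) // ∀ u v, α u = α v ↔ r t u.1 v.1} :=
      { toFun := fun a t => ⟨fun v => a.1 v.1 ⟨t, v.2⟩, fun u v => by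
          refine Iff.trans ?_ (iff_of_eq (congrFun₃ a.2 t u.1 v.1))
          exact ⟨fun h => ⟨u.2, v.2, h⟩, fun ⟨_, _, h⟩ => h⟩⟩
        invFun := fun α => ⟨fun v t => (α t.1).1 ⟨v, t.2⟩, by
          ext t u v
          constructor
          · rintro ⟨hu, hv, h⟩
            exact ((α t).2 ⟨u, hu⟩ ⟨v, hv⟩).1 h
          · intro h
            obtain ⟨hu, hv⟩ := hr t u v h
            exact ⟨hu, hv, ((α t).2 ⟨u, hu⟩ ⟨v, hv⟩).2 h⟩⟩
        left_inv := fun a => rfl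
        right_inv := fun α => rfl }
    rw [Nat.card_congr key, Nat.card_pi, map_prod, Nat.cast_prod]
    refine Finset.prod_congr rfl fun t _ => ?_
    rw [hq t, MvPolynomial.eval_toMvPolynomial]
  · refine ⟨0, fun k => ?_⟩
    have : IsEmpty {a : ∀ v, ∀ t : Set.Iic (σ v), Fin (k t) // branchPattern a = r} := by
      refine ⟨fun a => hr fun t u v h => ?_⟩
      rw [← a.2] at h
      exact ⟨h.1, h.2.1⟩
    simp

/-! ### Homomorphism numbers of compositions of branchings -/

theorem homNumber_eq_sum {K : Type*} [CommSemiring K] {V E : Type} [Fintype V] [Fintype E]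
    [DecidableEq V] (ends : E → V × V) (H : WGraph K) [Fintype H.V] :
    homNumber ends H = ∑ f : V → H.V, ∏ e : E, H.w (f (ends e).1) (f (ends e).2) :=
  finsum_eq_sum_of_fintype _

/-- Sums over families of vertices of several weighted graphs factorise into homomorphism
numbers. -/
theorem exists_mvPolynomial_sum_fibres {K : Type*} [CommSemiring K] {h : ℕ} {V E τ : Type}
    [Fintype V] [Fintype E] [Finite τ] [DecidableEq V] (ends : E → V × V) (F : τ → GraphSeq K h)
    (hF : ∀ s, IsStronglyPolynomial (F s)) [∀ s j, Fintype (F s j).V] (σ : V → τ)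
    (hσ : ∀ e, σ (ends e).1 = σ (ends e).2) :
    ∃ q : MvPolynomial (Fin h) K, ∀ j : Fin h → ℕ+,
      ∑ b : ∀ v, (F (σ v) j).V, ∏ e,
        (F (σ (ends e).2) j).w (hσ e ▸ b (ends e).1) (b (ends e).2) =
        MvPolynomial.eval (fun i => ((j i : ℕ) : K)) q := by
  classical
  have := Fintype.ofFinite τ
  -- No edge leaves its fibre, so the multigraph splits into pieces, one over each `s`; expanding
  -- the product of their homomorphism numbers gives the sum.
  let D : ∀ s, {e // σ (ends e).2 = s} → {v // σ v = s} × {v // σ v = s} :=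
    fun s e => (⟨(ends e.1).1, (hσ e).trans e.2⟩, ⟨(ends e.1).2, e.2⟩)
  choose q hq using fun s => hF s _ _ (D s)
  refine ⟨∏ s, q s, fun j => ?_⟩
  rw [map_prod]
  simp_rw [← hq, homNumber_eq_sum]
  rw [Finset.prod_univ_sum, Fintype.piFinset_univ]
  let ε : (∀ v, (F (σ v) j).V) ≃ ∀ s, {v // σ v = s} → (F s j).V :=
    { toFun := fun b s v => v.2 ▸ b v.1
      invFun := fun g v => g (σ v) ⟨v, rfl⟩
      left_inv := fun b => rfl
      right_inv := fun g => by
        ext s ⟨v, rfl⟩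
        rfl }
  rw [← Equiv.sum_comp ε.symm]
  refine Finset.sum_congr rfl fun g _ => ?_
  have hcast : ∀ {s s' : τ} (e : s = s') (u : V) (hu : σ u = s),
      (e ▸ g s ⟨u, hu⟩ : (F s' j).V) = g s' ⟨u, hu.trans e⟩ := by
    rintro s _ rfl u hu
    rfl
  rw [← Fintype.prod_sigma (fun x : Σ s, {e // σ (ends e).2 = s} =>
    (F x.1 j).w (g x.1 (D x.1 x.2).1) (g x.1 (D x.1 x.2).2)),
    ← Equiv.prod_comp (Equiv.sigmaFiberEquiv fun e => σ (ends e).2)]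
  refine Finset.prod_congr rfl fun ⟨s, e, he⟩ _ => ?_
  subst he
  change (F (σ (ends e).2) j).w (hσ e ▸ g _ ⟨(ends e).1, rfl⟩) (g _ ⟨(ends e).2, rfl⟩) = _
  rw [hcast]

namespace ColouredTree

variable {K : Type*} [CommRing K] {h : ℕ} (T : ColouredTree K h)

open Classical in
/-- The weight of a pair of vertices of a composition of a branching of `T`, expressed through the
pattern `r` of the coincidences between the chosen branches. -/
noncomputable def patternWeight {V : Type} {j : Fin h → ℕ+} (σ : V → T.tree)
    (r : T.tree → V → V → Prop) (b : ∀ v, (T.orn (σ v) j).V) (u v : V) : K :=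
  if e : σ u = σ v ∧ ∀ t ≤ σ u, r t u v then (T.orn (σ v) j).w (e.1 ▸ b u) (b v)
  else if T.graph.Adj (σ u) (σ v) ∧ ∀ t, t ≤ σ u → t ≤ σ v → r t u v then 1 else 0

/-- Two copies are equal exactly when they lie over the same tree vertex and agree along its whole
path to the root; both this and adjacency can be read off the pattern. -/
theorem comp_branch_w {V : Type} {j : Fin h → ℕ+} {k : T.tree → ℕ+} (σ : V → T.tree)
    (a : ∀ v, ∀ t : Set.Iic (σ v), Fin (k t)) (b : ∀ v, (T.orn (σ v) j).V) (u v : V) :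
    ((T.branch k).comp j).w ⟨⟨σ u, a u⟩, b u⟩ ⟨⟨σ v, a v⟩, b v⟩ =
      T.patternWeight σ (branchPattern a) b u v := by
  classical
  have aux : ∀ (s s' : T.tree) (α : ∀ t : Set.Iic s, Fin (k t)) (α' : ∀ t : Set.Iic s', Fin (k t)),
      ((⟨s, α⟩ : T.Copy k) = ⟨s', α'⟩) ↔
        s = s' ∧ ∀ t, t ≤ s → ∃ (hu : t ≤ s) (hv : t ≤ s'), α ⟨t, hu⟩ = α' ⟨t, hv⟩ := by
    intro s s' α α'
    constructor
    · intro e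
      cases e
      exact ⟨rfl, fun t ht => ⟨ht, ht, rfl⟩⟩
    · rintro ⟨rfl, e⟩
      congr 1
      ext1 ⟨t, ht⟩
      exact (e t ht).2.2
  have cast : ∀ (x y : T.Copy k) (e : x = y) (β : (T.orn x.1 j).V),
      (e ▸ β : (T.orn y.1 j).V) = (congrArg Sigma.fst e) ▸ β := by
    rintro x _ rfl β
    rfl
  unfold patternWeight
  by_cases e : (⟨σ u, a u⟩ : T.Copy k) = ⟨σ v, a v⟩
  · have e' := (aux _ _ _ _).1 e
    rw [dif_pos (show σ u = σ v ∧ ∀ t ≤ σ u, branchPattern a t u v from e')]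
    refine (dif_pos e).trans ?_
    exact congrArg (fun β => (T.orn (σ v) j).w β (b v)) (cast _ _ e _)
  · have e' := mt (aux _ _ _ _).2 e
    rw [dif_neg (show ¬ (σ u = σ v ∧ ∀ t ≤ σ u, branchPattern a t u v) from e')]
    refine (dif_neg e).trans ?_
    refine if_congr (and_congr Iff.rfl (forall_congr' fun t => ?_)) rfl rfl
    exact ⟨fun H hu hv => ⟨hu, hv, Fin.ext (H hu hv)⟩,
      fun H hu hv => congrArg Fin.val (H hu hv).2.2⟩

/-- Only edges whose ends land in the same copy depend on the ornament points. The others contribute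
a constant `0` or `1`, which factors out. -/
theorem exists_mvPolynomial_sum_patternWeight (hT : ∀ s, IsStronglyPolynomial (T.orn s))
    [∀ s j, Fintype (T.orn s j).V] {V E : Type} [Fintype V] [Fintype E] [DecidableEq V]
    (ends : E → V × V) (σ : V → T.tree) (r : T.tree → V → V → Prop) :
    ∃ q : MvPolynomial (Fin h) K, ∀ j : Fin h → ℕ+,
      ∑ b : ∀ v, (T.orn (σ v) j).V, ∏ e, T.patternWeight σ r b (ends e).1 (ends e).2 =
        MvPolynomial.eval (fun i => ((j i : ℕ) : K)) q := by
  classical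
  let p : E → Prop := fun e => σ (ends e).1 = σ (ends e).2 ∧ ∀ t ≤ σ (ends e).1,
    r t (ends e).1 (ends e).2
  obtain ⟨q, hq⟩ := exists_mvPolynomial_sum_fibres (fun e : {e // p e} => ends e.1) T.orn hT σ
    fun e => e.2.1
  let c : E → K := fun e => if T.graph.Adj (σ (ends e).1) (σ (ends e).2) ∧
    ∀ t, t ≤ σ (ends e).1 → t ≤ σ (ends e).2 → r t (ends e).1 (ends e).2 then 1 else 0
  refine ⟨MvPolynomial.C (∏ e : {e // ¬ p e}, c e) * q, fun j => ?_⟩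
  rw [map_mul, ← hq, MvPolynomial.eval_C, Finset.mul_sum]
  refine Finset.sum_congr rfl fun b _ => ?_
  rw [← Fintype.prod_subtype_mul_prod_subtype p, mul_comm]
  congr 1
  · exact Finset.prod_congr rfl fun e _ => by
      rw [patternWeight, dif_neg e.2]
  · exact Finset.prod_congr rfl fun e _ => by
      rw [patternWeight, dif_pos e.2]

theorem isStronglyPolynomial_comp_branch (hT : ∀ s, IsStronglyPolynomial (T.orn s)) :
    IsStronglyPolynomial (σ := T.tree ⊕ Fin h)
      (fun x => (T.branch fun s => x (Sum.inl s)).comp fun i => x (Sum.inr i)) := by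
  classical
  intro V E _ _ ends
  have := Fintype.ofFinite T.tree
  let _ : ∀ s j, Fintype (T.orn s j).V := fun s j => Fintype.ofFinite _
  choose q hq using fun σ : V → T.tree => exists_mvPolynomial_card_branchPattern K σ
  choose q' hq' using T.exists_mvPolynomial_sum_patternWeight hT ends
  refine ⟨∑ σ : V → T.tree, ∑ r : T.tree → V → V → Prop,
    MvPolynomial.rename Sum.inl (q σ r) * MvPolynomial.rename Sum.inr (q' σ r), fun x => ?_⟩
  simp only [map_sum, map_mul, MvPolynomial.eval_rename]
  set k : T.tree → ℕ+ := fun s => x (Sum.inl s) with hk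
  set j : Fin h → ℕ+ := fun i => x (Sum.inr i) with hj
  let _ : Fintype ((T.branch k).comp j).V := Fintype.ofFinite _
  rw [homNumber_eq_sum]
  let ε : (V → ((T.branch k).comp j).V) ≃
      Σ σ : V → T.tree, (∀ v, ∀ t : Set.Iic (σ v), Fin (k t)) × (∀ v, (T.orn (σ v) j).V) :=
    { toFun := fun f => ⟨fun v => (f v).1.1, fun v => (f v).1.2, fun v => (f v).2⟩
      invFun := fun y v => ⟨⟨y.1 v, y.2.1 v⟩, y.2.2 v⟩
      left_inv := fun f => rfl
      right_inv := fun y => rfl }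
  rw [← Equiv.sum_comp ε.symm, Fintype.sum_sigma]
  refine Finset.sum_congr rfl fun σ _ => ?_
  rw [Fintype.sum_prod_type]
  have hw : ∀ (a : ∀ v, ∀ t : Set.Iic (σ v), Fin (k t)) (b : ∀ v, (T.orn (σ v) j).V),
      ∏ e, ((T.branch k).comp j).w (ε.symm ⟨σ, a, b⟩ (ends e).1) (ε.symm ⟨σ, a, b⟩ (ends e).2) =
        ∏ e, T.patternWeight σ (branchPattern a) b (ends e).1 (ends e).2 :=
    fun a b => Finset.prod_congr rfl fun e _ => T.comp_branch_w σ a b _ _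
  simp_rw [hw]
  -- On the choices with a given pattern the inner sum is constant, so each pattern contributes its
  -- count times a polynomial in `j`.
  rw [← Finset.sum_fiberwise Finset.univ
    (fun a : ∀ v, ∀ t : Set.Iic (σ v), Fin (k t) => branchPattern a)]
  refine Finset.sum_congr rfl fun r _ => ?_
  have hr : ∀ a ∈ Finset.univ.filter
      (fun a : ∀ v, ∀ t : Set.Iic (σ v), Fin (k t) => branchPattern a = r),
      ∑ b : ∀ v, (T.orn (σ v) j).V,
        ∏ e, T.patternWeight σ (branchPattern a) b (ends e).1 (ends e).2 =
      MvPolynomial.eval (fun i => ((j i : ℕ) : K)) (q' σ r) := by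
    intro a ha
    rw [(Finset.mem_filter.1 ha).2, hq']
  rw [Finset.sum_congr rfl hr, Finset.sum_const, nsmul_eq_mul]
  congr 1
  rw [← Fintype.card_subtype, ← Nat.card_eq_fintype_card, hq]
  rfl

theorem isStronglyPolynomial_comp_branch_fixed (hT : ∀ s, IsStronglyPolynomial (T.orn s))
    (j : Fin h → ℕ+) : IsStronglyPolynomial (fun k => (T.branch k).comp j) := by
  intro V E _ _ ends
  obtain ⟨p, hp⟩ := T.isStronglyPolynomial_comp_branch hT V E ends
  refine ⟨MvPolynomial.bind₁
    (Sum.elim MvPolynomial.X fun i => MvPolynomial.C (((j i : ℕ) : K))) p, fun k => ?_⟩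
  refine (hp (Sum.elim k j)).trans ?_
  rw [← MvPolynomial.coe_aeval_eq_eval, ← MvPolynomial.coe_aeval_eq_eval]
  simp only [RingHom.coe_coe]
  rw [MvPolynomial.aeval_bind₁]
  congr 2
  ext i
  cases i <;> simp

end ColouredTree

end Polynomiality

/-! ### Isomorphisms -/

section Isomorphisms

theorem WGraph.Iso.refl {K : Type*} (A : WGraph K) : A.Iso A := ⟨Equiv.refl _, fun _ _ => rfl⟩

theorem WGraph.Iso.symm {K : Type*} {A B : WGraph K} : A.Iso B → B.Iso A
  | ⟨e, he⟩ => ⟨e.symm, fun x y => by simpa using (he (e.symm x) (e.symm y)).symm⟩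

theorem WGraph.Iso.trans {K : Type*} {A B C : WGraph K} : A.Iso B → B.Iso C → A.Iso C
  | ⟨e, he⟩, ⟨f, hf⟩ => ⟨e.trans f, fun x y => (hf _ _).trans (he x y)⟩

variable {K : Type*} {h : ℕ}

theorem GraphSeq.Iso.refl (F : GraphSeq K h) : F.Iso F := fun _ => WGraph.Iso.refl _

theorem GraphSeq.Iso.symm {F F' : GraphSeq K h} (e : F.Iso F') : F'.Iso F := fun j => (e j).symm

theorem GraphSeq.Iso.trans {F F' F'' : GraphSeq K h} (e : F.Iso F') (e' : F'.Iso F'') :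
    F.Iso F'' := fun j => (e j).trans (e' j)

theorem OrnamentedGraph.Iso.symm {X Y : OrnamentedGraph K h} : X.Iso Y → Y.Iso X
  | ⟨e, he⟩ => ⟨e.symm, fun v => by
      have := (he (e.symm v)).symm
      rwa [e.apply_symm_apply] at this⟩

theorem OrnamentedGraph.Iso.trans {X Y Z : OrnamentedGraph K h} :
    X.Iso Y → Y.Iso Z → X.Iso Z
  | ⟨e, he⟩, ⟨f, hf⟩ => ⟨e.trans f, fun v => (he v).trans (hf _)⟩

theorem OrnamentedGraph.Iso.comp [CommSemiring K] {X Y : OrnamentedGraph K h}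
    (hXY : X.Iso Y) (j : Fin h → ℕ+) : (X.comp j).Iso (Y.comp j) := by
  classical
  obtain ⟨e, he⟩ := hXY
  choose f hf using fun v => he v j
  refine ⟨Equiv.sigmaCongr e.toEquiv f, ?_⟩
  rintro ⟨u, x⟩ ⟨v, y⟩
  by_cases huv : u = v
  · subst huv
    refine (dif_pos rfl).trans (Eq.trans ?_ (dif_pos rfl).symm)
    exact hf u x y
  · refine (dif_neg (fun h' => huv (e.injective h'))).trans (Eq.trans ?_ (dif_neg huv).symm)
    exact if_congr e.map_adj_iff rfl rfl

end Isomorphisms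

namespace ColouredTree

variable {K : Type*} {h : ℕ} (T : ColouredTree K h)

/-! ### The elimination of isomorphic branches -/

theorem treeLevel_lt_treeLevel {s t : T.tree} (hst : s < t) : treeLevel s < treeLevel t :=
  Set.ncard_lt_ncard (Set.Iio_ssubset_Iio hst) (Set.toFinite _)

/-- The ancestors of `v` form a chain, so a level singles out one of them. This is why the colours
determine the graph. -/
theorem adj_iff_treeLevel_mem {v w : T.tree} (hwv : w ≤ v) :
    T.graph.Adj v w ↔ treeLevel w ∈ T.levels v := by
  refine ⟨fun hvw => ⟨w, hwv, hvw, rfl⟩, ?_⟩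
  rintro ⟨t, htv, hvt, htw⟩
  suffices t = w from this ▸ hvt
  by_contra hne
  rcases le_total_of_directed hwv htv with hle | hle
  · exact (T.treeLevel_lt_treeLevel (lt_of_le_of_ne hle hne)).ne htw
  · exact (T.treeLevel_lt_treeLevel (lt_of_le_of_ne hle (Ne.symm hne))).ne htw.symm

theorem comparable_of_adj {v w : T.tree} (hvw : T.graph.Adj v w) : v ≤ w ∨ w ≤ v :=
  ((SimpleGraph.fromRel_adj _ _ _).1 (T.graph_le hvw)).2

theorem not_le_of_pred_eq {s t : T.tree} (hst : s ≠ t) (hs : s ≠ ⊥)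
    (hpred : Order.pred s = Order.pred t) : ¬ s ≤ t := fun hle => by
  have h1 : s ≤ Order.pred s := hpred ▸ Order.le_pred_of_lt (lt_of_le_of_ne hle hst)
  have h2 : IsMin s := Order.min_of_le_pred h1
  exact hs (isMin_iff_eq_bot.1 h2)

/-- The data of an involution that exchanges two isomorphic sibling branches at a stage of the
reduction, and fixes the other vertices. -/
structure BranchSwap (c : T.Stage) (s t : T.tree) (θ : T.tree → T.tree) : Prop where
  invol : ∀ x, θ (θ x) = x
  mem : ∀ x ∈ c.1, θ x ∈ c.1
  mono : ∀ x ∈ c.1, ∀ y ∈ c.1, x ≤ y → θ x ≤ θ y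
  map_left : θ s = t
  fix : ∀ x, ¬ s ≤ x → ¬ t ≤ x → θ x = x
  levels : ∀ x ∈ c.1, T.levels (θ x) = T.levels x
  orn : ∀ x ∈ c.1, (T.orn x).Iso (T.orn (θ x))
  mult : ∀ x ∈ c.1, x ≠ s → x ≠ t → c.2 (θ x) = c.2 x

/-- The involution is `φ` on one branch, its inverse on the other and the identity elsewhere. It is
monotone because siblings have the same proper ancestors. -/
theorem exists_branchSwap {c : T.Stage} {s t : T.tree} (hs : s ∈ c.1) (ht : t ∈ c.1)
    (hne : s ≠ t) (hsb : s ≠ ⊥) (htb : t ≠ ⊥) (hpred : Order.pred s = Order.pred t)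
    (hiso : T.BranchesIso c s t) : ∃ θ, T.BranchSwap c s t θ := by
  classical
  obtain ⟨φ, hφ⟩ := hiso
  have hnst := T.not_le_of_pred_eq hne hsb hpred
  have hnts := T.not_le_of_pred_eq hne.symm htb hpred.symm
  have hdisj : ∀ x, s ≤ x → t ≤ x → False := fun x h1 h2 =>
    (le_total_of_directed h2 h1).elim hnst hnts
  let θ : T.tree → T.tree := fun x =>
    if h : x ∈ c.1 ∧ s ≤ x then φ ⟨x, h⟩ else if h : x ∈ c.1 ∧ t ≤ x then φ.symm ⟨x, h⟩ else x
  have θs : ∀ (x) (h : x ∈ c.1 ∧ s ≤ x), θ x = φ ⟨x, h⟩ := fun x h => dif_pos h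
  have θt : ∀ (x) (h : x ∈ c.1 ∧ t ≤ x), θ x = φ.symm ⟨x, h⟩ := fun x h =>
    (dif_neg fun h' => hdisj x h'.2 h.2).trans (dif_pos h)
  have θn : ∀ x, ¬ (x ∈ c.1 ∧ s ≤ x) → ¬ (x ∈ c.1 ∧ t ≤ x) → θ x = x := fun x h h' =>
    (dif_neg h).trans (dif_neg h')
  -- An order isomorphism matches the least elements of the two branches.
  have hφs : (φ ⟨s, hs, le_rfl⟩ : T.tree) = t := by
    apply le_antisymm _ (φ ⟨s, hs, le_rfl⟩).2.2
    have := φ.monotone (show (⟨s, hs, le_rfl⟩ : {x // x ∈ c.1 ∧ s ≤ x}) ≤ φ.symm ⟨t, ht, le_rfl⟩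
      from (φ.symm ⟨t, ht, le_rfl⟩).2.2)
    rw [φ.apply_symm_apply] at this
    exact this
  have hlt : ∀ (a b x : T.tree), Order.pred a = Order.pred b → x < a → x ≤ b :=
    fun a b x hp hx => (Order.le_pred_of_lt hx).trans (hp ▸ Order.pred_le b)
  refine ⟨θ, ?_, ?_, ?_, ?_, ?_, ?_, ?_, ?_⟩
  · intro x
    by_cases h1 : x ∈ c.1 ∧ s ≤ x
    · rw [θs x h1, θt _ (φ ⟨x, h1⟩).2, Subtype.coe_eta, φ.symm_apply_apply]
    by_cases h2 : x ∈ c.1 ∧ t ≤ x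
    · rw [θt x h2, θs _ (φ.symm ⟨x, h2⟩).2, Subtype.coe_eta, φ.apply_symm_apply]
    rw [θn x h1 h2, θn x h1 h2]
  · intro x hx
    by_cases h1 : x ∈ c.1 ∧ s ≤ x
    · rw [θs x h1]
      exact (φ ⟨x, h1⟩).2.1
    by_cases h2 : x ∈ c.1 ∧ t ≤ x
    · rw [θt x h2]
      exact (φ.symm ⟨x, h2⟩).2.1
    rwa [θn x h1 h2]
  · intro x hx y hy hxy
    by_cases h1 : x ∈ c.1 ∧ s ≤ x
    · have h1' : y ∈ c.1 ∧ s ≤ y := ⟨hy, h1.2.trans hxy⟩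
      rw [θs x h1, θs y h1']
      exact φ.monotone (show (⟨x, h1⟩ : {x // x ∈ c.1 ∧ s ≤ x}) ≤ ⟨y, h1'⟩ from hxy)
    by_cases h2 : x ∈ c.1 ∧ t ≤ x
    · have h2' : y ∈ c.1 ∧ t ≤ y := ⟨hy, h2.2.trans hxy⟩
      rw [θt x h2, θt y h2']
      exact φ.symm.monotone (show (⟨x, h2⟩ : {x // x ∈ c.1 ∧ t ≤ x}) ≤ ⟨y, h2'⟩ from hxy)
    rw [θn x h1 h2]
    by_cases h3 : y ∈ c.1 ∧ s ≤ y
    · rw [θs y h3]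
      rcases lt_or_le_of_directed hxy h3.2 with h4 | h4
      · exact (hlt s t x hpred h4).trans (φ ⟨y, h3⟩).2.2
      · exact absurd ⟨hx, h4⟩ h1
    by_cases h3' : y ∈ c.1 ∧ t ≤ y
    · rw [θt y h3']
      rcases lt_or_le_of_directed hxy h3'.2 with h4 | h4
      · exact (hlt t s x hpred.symm h4).trans (φ.symm ⟨y, h3'⟩).2.2
      · exact absurd ⟨hx, h4⟩ h2
    rwa [θn y h3 h3']
  · rw [θs s ⟨hs, le_rfl⟩, hφs]
  · exact fun x h1 h2 => θn x (fun h => h1 h.2) (fun h => h2 h.2)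
  · intro x hx
    by_cases h1 : x ∈ c.1 ∧ s ≤ x
    · rw [θs x h1, ← (hφ ⟨x, h1⟩).1]
    by_cases h2 : x ∈ c.1 ∧ t ≤ x
    · rw [θt x h2, (hφ (φ.symm ⟨x, h2⟩)).1, φ.apply_symm_apply]
    rw [θn x h1 h2]
  · intro x hx
    by_cases h1 : x ∈ c.1 ∧ s ≤ x
    · rw [θs x h1]
      exact (hφ ⟨x, h1⟩).2.1
    by_cases h2 : x ∈ c.1 ∧ t ≤ x
    · rw [θt x h2]
      have := (hφ (φ.symm ⟨x, h2⟩)).2.1.symm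
      rwa [φ.apply_symm_apply] at this
    rw [θn x h1 h2]
    exact GraphSeq.Iso.refl _
  · intro x hx hxs hxt
    by_cases h1 : x ∈ c.1 ∧ s ≤ x
    · rw [θs x h1, ← (hφ ⟨x, h1⟩).2.2 hxs]
    by_cases h2 : x ∈ c.1 ∧ t ≤ x
    · rw [θt x h2, (hφ (φ.symm ⟨x, h2⟩)).2.2 ?_, φ.apply_symm_apply]
      intro h3
      apply hxt
      have h4 : φ.symm ⟨x, h2⟩ = ⟨s, hs, le_rfl⟩ := Subtype.ext h3
      rw [← hφs, ← h4, φ.apply_symm_apply]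
    rw [θn x h1 h2]

namespace BranchSwap

variable {T} {c : T.Stage} {s t : T.tree} {θ : T.tree → T.tree} (hθ : T.BranchSwap c s t θ)
include hθ

theorem map_right : θ t = s := by rw [← hθ.map_left, hθ.invol]

theorem injective : Function.Injective θ := (Function.Involutive.injective hθ.invol)

theorem mem_iff {x : T.tree} : θ x ∈ c.1 ↔ x ∈ c.1 :=
  ⟨fun hx => hθ.invol x ▸ hθ.mem _ hx, hθ.mem x⟩

theorem le_map_iff (hc : IsLowerSet c.1) {u v : T.tree} (hv : v ∈ c.1) : u ≤ θ v ↔ θ u ≤ v := by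
  constructor
  · intro huv
    have := hθ.mono u (hc huv (hθ.mem v hv)) _ (hθ.mem v hv) huv
    rwa [hθ.invol] at this
  · intro huv
    have := hθ.mono _ (hc huv hv) _ hv huv
    rwa [hθ.invol] at this

theorem treeLevel_map (hc : IsLowerSet c.1) {v : T.tree} (hv : v ∈ c.1) :
    treeLevel (θ v) = treeLevel v := by
  unfold treeLevel
  rw [← Set.ncard_image_of_injective (Set.Iio v) hθ.injective]
  congr 1
  ext u
  constructor
  · intro hu
    refine ⟨θ u, lt_of_le_of_ne ((hθ.le_map_iff hc hv).1 (le_of_lt hu)) ?_, hθ.invol u⟩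
    rintro rfl
    exact hu.ne (hθ.invol u).symm
  · rintro ⟨u, hu, rfl⟩
    exact lt_of_le_of_ne (hθ.mono _ (hc (le_of_lt hu) hv) _ hv (le_of_lt hu))
      (fun h => (ne_of_lt hu) (hθ.injective h))

/-- Adjacency to an ancestor is a matter of levels and colours, and the swap preserves both. -/
theorem adj_map (hc : IsLowerSet c.1) {v w : T.tree} (hv : v ∈ c.1) (hw : w ∈ c.1) :
    T.graph.Adj v w → T.graph.Adj (θ v) (θ w) := by
  have key : ∀ v w : T.tree, v ∈ c.1 → w ∈ c.1 → w ≤ v → T.graph.Adj v w →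
      T.graph.Adj (θ v) (θ w) := by
    intro v w hv hw hwv hvw
    rw [T.adj_iff_treeLevel_mem (hθ.mono w hw v hv hwv), hθ.levels v hv, hθ.treeLevel_map hc hw,
      ← T.adj_iff_treeLevel_mem hwv]
    exact hvw
  intro hvw
  rcases T.comparable_of_adj hvw with hle | hle
  · exact (key w v hw hv hle hvw.symm).symm
  · exact key v w hv hw hle hvw

theorem adj_map_iff (hc : IsLowerSet c.1) {v w : T.tree} (hv : v ∈ c.1) (hw : w ∈ c.1) :
    T.graph.Adj (θ v) (θ w) ↔ T.graph.Adj v w := by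
  refine ⟨fun hvw => ?_, hθ.adj_map hc hv hw⟩
  have := hθ.adj_map hc (hθ.mem v hv) (hθ.mem w hw) hvw
  rwa [hθ.invol, hθ.invol] at this

end BranchSwap

/-! ### ### Copies of vertices at a stage -/

/-- The copies, at the stage `c`, of the vertices of `T`: a vertex `v` that has not been deleted,
with a choice of branches at its ancestors (and the value `0` at all other vertices). -/
def StageCopy (c : T.Stage) : Type :=
  {x : T.tree × (T.tree → ℕ) //
    x.1 ∈ c.1 ∧ (∀ u ≤ x.1, x.2 u < c.2 u) ∧ ∀ u, ¬ u ≤ x.1 → x.2 u = 0}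

/-- Adjacency of copies of vertices of `T`. -/
def CopyAdj (x y : T.tree × (T.tree → ℕ)) : Prop :=
  T.graph.Adj x.1 y.1 ∧ ∀ u, u ≤ x.1 → u ≤ y.1 → x.2 u = y.2 u

/-- The branching of `T` at the stage `c` is isomorphic to the ornamented graph `X`. -/
def Represents (c : T.Stage) (X : OrnamentedGraph K h) : Prop :=
  ∃ e : T.StageCopy c ≃ X.V, (∀ x y, X.graph.Adj (e x) (e y) ↔ T.CopyAdj x.1 y.1) ∧
    ∀ x, (T.orn x.1.1).Iso (X.orn (e x))

theorem represents_univ : T.Represents (Set.univ, fun _ => 1) T.toOrnamentedGraph := by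
  have h0 : ∀ (x : T.StageCopy (Set.univ, fun _ => 1)) (u : T.tree), x.1.2 u = 0 := by
    intro x u
    by_cases hu : u ≤ x.1.1
    · simpa using x.2.2.1 u hu
    · exact x.2.2.2 u hu
  refine ⟨{ toFun := fun x => x.1.1
            invFun := fun v => ⟨(v, fun _ => 0), trivial, fun _ _ => Nat.one_pos, fun _ _ => rfl⟩
            left_inv := fun x => Subtype.ext (Prod.ext rfl (funext fun u => (h0 x u).symm))
            right_inv := fun v => rfl }, fun x y => ?_, fun x => GraphSeq.Iso.refl _⟩
  exact ⟨fun hxy => ⟨hxy, fun u _ _ => (h0 x u).trans (h0 y u).symm⟩, fun hxy => hxy.1⟩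

end ColouredTree

/-! ### ### Merging two isomorphic sibling branches -/

namespace ColouredTree

variable {K : Type*} {h : ℕ} {T : ColouredTree K h}

open Classical in
/-- The stage that is reached by deleting the branch at `t` and adding its multiplicity to that
of `s`. -/
noncomputable def mergeStage (c : T.Stage) (s t : T.tree) : T.Stage :=
  (c.1 \ Set.Ici t, Function.update c.2 s (c.2 s + c.2 t))

open Classical in
/-- A copy of `v` after the merger of the branches at `s` and `t` that belongs to one of the last
`m t` branches at `s` is a copy of `θ v` before the merger. -/
noncomputable def unmerge (c : T.Stage) (s t : T.tree) (θ : T.tree → T.tree)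
    (x : T.tree × (T.tree → ℕ)) : T.tree × (T.tree → ℕ) :=
  if s ≤ x.1 ∧ c.2 s ≤ x.2 s then (θ x.1, Function.update (x.2 ∘ θ) t (x.2 s - c.2 s)) else x

open Classical in
/-- The inverse of `unmerge`. -/
noncomputable def merge (c : T.Stage) (s t : T.tree) (θ : T.tree → T.tree)
    (x : T.tree × (T.tree → ℕ)) : T.tree × (T.tree → ℕ) :=
  if t ≤ x.1 then (θ x.1, Function.update (x.2 ∘ θ) s (x.2 t + c.2 s)) else x

section

variable {c : T.Stage} {s t : T.tree} {θ : T.tree → T.tree} (hθ : T.BranchSwap c s t θ)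
  (hc : IsLowerSet c.1) (hdisj : ∀ x : T.tree, s ≤ x → ¬ t ≤ x)

include hθ hc hdisj

/-- A moved copy has its value at `s` in `[c.2 s, c.2 s + c.2 t)`, so subtracting `c.2 s` gives a
valid choice at `t`. At its other ancestors the swap preserves multiplicities. -/
theorem unmerge_mem (x : T.StageCopy (mergeStage c s t)) :
    (unmerge c s t θ x.1).1 ∈ c.1 ∧
      (∀ u ≤ (unmerge c s t θ x.1).1, (unmerge c s t θ x.1).2 u < c.2 u) ∧
      ∀ u, ¬ u ≤ (unmerge c s t θ x.1).1 → (unmerge c s t θ x.1).2 u = 0 := by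
  classical
  obtain ⟨⟨v, a⟩, ⟨hv, hvt⟩, hlt, h0⟩ := x
  simp only [mergeStage] at hlt h0 hv hvt
  have hvt : ¬ t ≤ v := hvt
  unfold unmerge
  dsimp only
  split_ifs with hsv
  · have htv : t ≤ θ v := (hθ.le_map_iff hc hv).2 (hθ.map_right ▸ hsv.1)
    refine ⟨hθ.mem v hv, fun u hu => ?_, fun u hu => ?_⟩
    · dsimp only at hu ⊢
      rw [hθ.le_map_iff hc hv] at hu
      by_cases hut : u = t
      · subst hut
        have := hlt s hsv.1
        rw [Function.update_self] at this ⊢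
        have h2 := hsv.2
        push_cast at this
        omega
      · have hus : u ≠ s := by
          rintro rfl
          exact hvt (hθ.map_left ▸ hu)
        have hus' : θ u ≠ s := fun e => hut (by rw [← hθ.invol u, e, hθ.map_left])
        have := hlt _ hu
        rw [Function.update_of_ne hus', hθ.mult u ?_ hus hut] at this
        · rwa [Function.update_of_ne hut]
        · exact hθ.mem_iff.1 (hc hu hv)
    · dsimp only at hu ⊢
      rw [Function.update_of_ne (fun e : u = t => hu (e ▸ htv))]
      exact h0 _ (fun h' => hu ((hθ.le_map_iff hc hv).2 h'))
  · refine ⟨hv, fun u hu => ?_, h0⟩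
    by_cases hus : u = s
    · subst hus
      exact not_le.1 fun h' => hsv ⟨hu, h'⟩
    · have := hlt u hu
      rwa [Function.update_of_ne hus] at this

theorem merge_mem (x : T.StageCopy c) :
    (merge c s t θ x.1).1 ∈ (mergeStage c s t).1 ∧
      (∀ u ≤ (merge c s t θ x.1).1, (merge c s t θ x.1).2 u < (mergeStage c s t).2 u) ∧
      ∀ u, ¬ u ≤ (merge c s t θ x.1).1 → (merge c s t θ x.1).2 u = 0 := by
  classical
  obtain ⟨⟨v, a⟩, hv, hlt, h0⟩ := x
  simp only [mergeStage] at hlt h0 hv ⊢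
  unfold merge
  dsimp only
  split_ifs with htv
  · have hsv : s ≤ θ v := (hθ.le_map_iff hc hv).2 (hθ.map_left ▸ htv)
    refine ⟨⟨hθ.mem v hv, fun h' => hdisj _ hsv h'⟩, fun u hu => ?_, fun u hu => ?_⟩
    · dsimp only at hu ⊢
      have hut : u ≠ t := by
        rintro rfl
        exact hdisj _ hsv hu
      rw [hθ.le_map_iff hc hv] at hu
      by_cases hus : u = s
      · subst hus
        have := hlt t htv
        rw [Function.update_self, Function.update_self]
        push_cast
        omega
      · have := hlt _ hu
        rw [hθ.mult u (hθ.mem_iff.1 (hc hu hv)) hus hut] at this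
        rwa [Function.update_of_ne hus, Function.update_of_ne hus]
    · dsimp only at hu ⊢
      rw [Function.update_of_ne (fun e : u = s => hu (e ▸ hsv))]
      exact h0 _ (fun h' => hu ((hθ.le_map_iff hc hv).2 h'))
  · refine ⟨⟨hv, htv⟩, fun u hu => ?_, h0⟩
    by_cases hus : u = s
    · subst hus
      have := hlt u hu
      rw [Function.update_self]
      push_cast
      omega
    · rw [Function.update_of_ne hus]
      exact hlt u hu

theorem merge_unmerge (x : T.StageCopy (mergeStage c s t)) :
    merge c s t θ (unmerge c s t θ x.1) = x.1 := by
  classical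
  obtain ⟨⟨v, a⟩, ⟨hv, hvt⟩, hlt, h0⟩ := x
  have hvt : ¬ t ≤ v := hvt
  have hv : v ∈ c.1 := hv
  unfold unmerge
  dsimp only
  split_ifs with hsv
  · have htv : t ≤ θ v := (hθ.le_map_iff hc hv).2 (hθ.map_right ▸ hsv.1)
    rw [merge, if_pos htv]
    refine Prod.ext (hθ.invol v) (funext fun u => ?_)
    by_cases hus : u = s
    · subst hus
      simp only [Function.update_self]
      exact Nat.sub_add_cancel hsv.2
    · have hut : θ u ≠ t := fun e => hus (by rw [← hθ.invol u, e, hθ.map_right])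
      simp only [Function.update_of_ne hus, Function.comp, Function.update_of_ne hut, hθ.invol]
  · exact if_neg hvt

theorem unmerge_merge (x : T.StageCopy c) :
    unmerge c s t θ (merge c s t θ x.1) = x.1 := by
  classical
  obtain ⟨⟨v, a⟩, hv, hlt, h0⟩ := x
  have hv : v ∈ c.1 := hv
  unfold merge
  dsimp only
  split_ifs with htv
  · have hsv : s ≤ θ v := (hθ.le_map_iff hc hv).2 (hθ.map_left ▸ htv)
    rw [unmerge, if_pos ⟨hsv, by simp⟩]
    refine Prod.ext (hθ.invol v) (funext fun u => ?_)
    by_cases hut : u = t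
    · subst hut
      simp only [Function.update_self]
      exact Nat.add_sub_cancel _ _
    · have hus : θ u ≠ s := fun e => hut (by rw [← hθ.invol u, e, hθ.map_left])
      simp only [Function.update_of_ne hus, Function.comp, Function.update_of_ne hut, hθ.invol]
  · exact if_neg fun h' => absurd (hlt s h'.1) (not_lt.2 h'.2)

/-- If the unmoved copy also lies above `s`, neither side holds: the two copies take different
branches at `s` after the merger, and lie over incomparable vertices before it. Otherwise the swap
fixes the unmoved vertex and all its ancestors. -/
theorem copyAdj_unmerge_of_not {x y : T.StageCopy (mergeStage c s t)}
    (hx : s ≤ x.1.1 ∧ c.2 s ≤ x.1.2 s) (hy : ¬ (s ≤ y.1.1 ∧ c.2 s ≤ y.1.2 s)) :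
    T.CopyAdj (unmerge c s t θ x.1) (unmerge c s t θ y.1) ↔ T.CopyAdj x.1 y.1 := by
  classical
  obtain ⟨⟨v, a⟩, ⟨hv, hvt⟩, hlt, h0⟩ := x
  obtain ⟨⟨w, b⟩, ⟨hw, hwt⟩, hlt', h0'⟩ := y
  have hvt : ¬ t ≤ v := hvt
  have hwt : ¬ t ≤ w := hwt
  have hv : v ∈ c.1 := hv
  have hw : w ∈ c.1 := hw
  dsimp only at hx hy
  have htv : t ≤ θ v := (hθ.le_map_iff hc hv).2 (hθ.map_right ▸ hx.1)
  rw [unmerge, if_pos hx, unmerge, if_neg hy]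
  by_cases hsw : s ≤ w
  · constructor
    · rintro ⟨hadj, -⟩
      exfalso
      rcases T.comparable_of_adj hadj with hle | hle
      · exact hwt (htv.trans hle)
      · exact hdisj _ (hsw.trans hle) htv
    · rintro ⟨-, hagree⟩
      exact absurd ⟨hsw, hx.2.trans_eq (hagree s hx.1 hsw)⟩ hy
  · have hwθ := hθ.fix w hsw hwt
    unfold CopyAdj
    refine and_congr ?_ (forall_congr' fun u => ?_)
    · dsimp only
      conv_lhs => rw [← hwθ]
      exact hθ.adj_map_iff hc hv hw
    · dsimp only
      have hu : u ≤ w → θ u = u ∧ u ≠ t := fun h' =>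
        ⟨hθ.fix u (fun hsu => hsw (hsu.trans h')) (fun htu => hwt (htu.trans h')),
          fun e => hwt (e ▸ h')⟩
      constructor
      · intro H h1 h2
        have := H ((hθ.le_map_iff hc hv).2 ((hu h2).1.symm ▸ h1)) h2
        rwa [Function.update_of_ne (hu h2).2, Function.comp, (hu h2).1] at this
      · intro H h1 h2
        rw [Function.update_of_ne (hu h2).2, Function.comp, (hu h2).1]
        exact H ((hu h2).1 ▸ (hθ.le_map_iff hc hv).1 h1) h2

theorem copyAdj_unmerge (x y : T.StageCopy (mergeStage c s t)) :
    T.CopyAdj (unmerge c s t θ x.1) (unmerge c s t θ y.1) ↔ T.CopyAdj x.1 y.1 := by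
  classical
  have hcomm : ∀ x y, T.CopyAdj x y ↔ T.CopyAdj y x := fun x y =>
    ⟨fun H => ⟨H.1.symm, fun u h1 h2 => (H.2 u h2 h1).symm⟩,
      fun H => ⟨H.1.symm, fun u h1 h2 => (H.2 u h2 h1).symm⟩⟩
  by_cases hx : s ≤ x.1.1 ∧ c.2 s ≤ x.1.2 s
  · by_cases hy : s ≤ y.1.1 ∧ c.2 s ≤ y.1.2 s
    · obtain ⟨⟨v, a⟩, ⟨hv, hvt⟩, hlt, h0⟩ := x
      obtain ⟨⟨w, b⟩, ⟨hw, hwt⟩, hlt', h0'⟩ := y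
      have hv : v ∈ c.1 := hv
      have hw : w ∈ c.1 := hw
      dsimp only at hx hy
      rw [unmerge, if_pos hx, unmerge, if_pos hy]
      refine and_congr (hθ.adj_map_iff hc hv hw) ?_
      dsimp only
      constructor
      · intro H u h1 h2
        have := H (θ u) ((hθ.le_map_iff hc hv).2 ((hθ.invol u).symm ▸ h1))
          ((hθ.le_map_iff hc hw).2 ((hθ.invol u).symm ▸ h2))
        by_cases hut : θ u = t
        · have hus : u = s := by rw [← hθ.invol u, hut, hθ.map_right]
          subst hus
          rw [hut, Function.update_self, Function.update_self] at this
          have h3 := hx.2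
          have h4 := hy.2
          omega
        · rwa [Function.update_of_ne hut, Function.update_of_ne hut, Function.comp,
            Function.comp, hθ.invol] at this
      · intro H u h1 h2
        by_cases hut : u = t
        · subst hut
          rw [Function.update_self, Function.update_self, H s hx.1 hy.1]
        · rw [Function.update_of_ne hut, Function.update_of_ne hut]
          exact H _ ((hθ.le_map_iff hc hv).1 h1) ((hθ.le_map_iff hc hw).1 h2)
    · exact copyAdj_unmerge_of_not hθ hc hdisj hx hy
  · by_cases hy : s ≤ y.1.1 ∧ c.2 s ≤ y.1.2 s
    · rw [hcomm, hcomm x.1, copyAdj_unmerge_of_not hθ hc hdisj hy hx]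
    · rw [unmerge, if_neg hx, unmerge, if_neg hy]

theorem Represents.mergeStage {X : OrnamentedGraph K h} (hX : T.Represents c X) :
    T.Represents (ColouredTree.mergeStage c s t) X := by
  obtain ⟨e, hadj, horn⟩ := hX
  let ε : T.StageCopy (ColouredTree.mergeStage c s t) ≃ T.StageCopy c :=
    { toFun := fun x => ⟨unmerge c s t θ x.1, unmerge_mem hθ hc hdisj x⟩
      invFun := fun x => ⟨merge c s t θ x.1, merge_mem hθ hc hdisj x⟩
      left_inv := fun x => Subtype.ext (merge_unmerge hθ hc hdisj x)
      right_inv := fun x => Subtype.ext (unmerge_merge hθ hc hdisj x) }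
  refine ⟨ε.trans e, fun x y => (hadj _ _).trans (copyAdj_unmerge hθ hc hdisj x y),
    fun x => GraphSeq.Iso.trans ?_ (horn (ε x))⟩
  change (T.orn x.1.1).Iso (T.orn (unmerge c s t θ x.1).1)
  unfold unmerge
  split_ifs
  · exact hθ.orn _ x.2.1.1
  · exact GraphSeq.Iso.refl _

end

/-! ### ### From the reduction to a branching of the core -/

/-- What holds at every stage of the reduction of a tree that encodes `X`. -/
structure StageInvariant (c : T.Stage) (X : OrnamentedGraph K h) : Prop where
  lower : IsLowerSet c.1
  bot_mem : ⊥ ∈ c.1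
  represents : T.Represents c X

theorem StageInvariant.step {c c' : T.Stage} {X : OrnamentedGraph K h}
    (hX : T.StageInvariant c X) (hstep : T.Step c c') : T.StageInvariant c' X := by
  obtain ⟨s, t, hs, ht, hne, hsb, htb, hpred, hiso, rfl⟩ := hstep
  obtain ⟨θ, hθ⟩ := T.exists_branchSwap hs ht hne hsb htb hpred hiso
  have hdisj : ∀ x : T.tree, s ≤ x → ¬ t ≤ x := fun x h1 h2 =>
    (le_total_of_directed h2 h1).elim (T.not_le_of_pred_eq hne hsb hpred)
      (T.not_le_of_pred_eq hne.symm htb hpred.symm)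
  exact ⟨fun u v huv hu => ⟨hX.lower huv hu.1, fun hv => hu.2 (le_trans hv huv)⟩,
    ⟨hX.bot_mem, fun hb => htb (le_bot_iff.1 hb)⟩,
    hX.represents.mergeStage hθ hX.lower hdisj⟩

theorem stageInvariant_univ : T.StageInvariant (Set.univ, fun _ => 1) T.toOrnamentedGraph :=
  ⟨isLowerSet_univ, trivial, T.represents_univ⟩

theorem StageInvariant.reflTransGen {c c' : T.Stage} {X : OrnamentedGraph K h}
    (hX : T.StageInvariant c X) (hstep : Relation.ReflTransGen T.Step c c') :
    T.StageInvariant c' X := by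
  induction hstep with
  | refl => exact hX
  | tail _ hs ih => exact ih.step hs

/-- Every step deletes at least the vertex `t`, so the reduction terminates. -/
theorem exists_isBranchingCore : ∃ c, T.IsBranchingCore c := by
  have key : ∀ (n : ℕ) (c : T.Stage), c.1.ncard = n →
      ∃ c', Relation.ReflTransGen T.Step c c' ∧ ∀ c'', ¬ T.Step c' c'' := by
    intro n
    induction n using Nat.strong_induction_on with
    | _ n ih =>
      intro c hcn
      by_cases hstep : ∃ c', T.Step c c'
      · obtain ⟨c', hc'⟩ := hstep
        have hlt : c'.1.ncard < n := by
          obtain ⟨s, t, hs, ht, -, -, -, -, -, rfl⟩ := hc'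
          rw [← hcn]
          exact Set.ncard_lt_ncard
            (Set.ssubset_iff_of_subset Set.sdiff_subset |>.2 ⟨t, ht, fun h' => h'.2 le_rfl⟩)
            (Set.toFinite _)
        obtain ⟨c'', h1, h2⟩ := ih _ hlt c' rfl
        exact ⟨c'', Relation.ReflTransGen.head hc' h1, h2⟩
      · exact ⟨c, Relation.ReflTransGen.refl, fun c' hc' => hstep ⟨c', hc'⟩⟩
  exact key _ _ rfl

/-- The coloured tree formed by the vertices that have not been deleted at a stage. -/
noncomputable def restrict (S : Set T.tree) (hS : IsLowerSet S) (hb : ⊥ ∈ S) :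
    ColouredTree K h :=
  haveI : S.OrdConnected := hS.ordConnected
  { tree :=
      { α := S
        semilatticeInf := Subtype.semilatticeInf fun _ _ hx _ => hS inf_le_left hx
        orderBot := Subtype.orderBot hb
        predOrder := Set.OrdConnected.predOrder
        isPredArchimedean := Set.OrdConnected.isPredArchimedean S }
    finite := Subtype.finite
    graph := T.graph.comap Subtype.val
    graph_le := fun x y hxy => by
      have := (SimpleGraph.fromRel_adj _ _ _).1 (T.graph_le hxy)
      exact (SimpleGraph.fromRel_adj _ _ _).2 ⟨fun e => this.1 (congrArg Subtype.val e), this.2⟩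
    orn := fun x => T.orn x.1 }

theorem Represents.iso_branch_restrict {c : T.Stage} {X : OrnamentedGraph K h}
    (hX : T.Represents c X) (hc : IsLowerSet c.1) (hb : ⊥ ∈ c.1) :
    X.Iso ((T.restrict c.1 hc hb).branch fun x => c.2 x.1) := by
  classical
  obtain ⟨e, hadj, horn⟩ := hX
  let ε : T.StageCopy c ≃ ((T.restrict c.1 hc hb).branch fun x => c.2 x.1).V :=
    { toFun := fun x => ⟨⟨x.1.1, x.2.1⟩, fun u => ⟨x.1.2 u.1.1, x.2.2.1 u.1.1 u.2⟩⟩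
      invFun := fun y => ⟨(y.1.1, fun u => if hu : u ≤ y.1.1 then
          (y.2 ⟨⟨u, hc hu y.1.2⟩, hu⟩ : ℕ) else 0), y.1.2,
        fun u hu => by
          dsimp only
          rw [dif_pos hu]
          exact (y.2 ⟨⟨u, hc hu y.1.2⟩, hu⟩).2,
        fun u hu => dif_neg hu⟩
      left_inv := fun x => by
        refine Subtype.ext (Prod.ext rfl (funext fun u => ?_))
        by_cases hu : u ≤ x.1.1
        · exact dif_pos hu
        · exact (dif_neg hu).trans (x.2.2.2 u hu).symm
      right_inv := fun y => by
        obtain ⟨v, a⟩ := y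
        refine Sigma.ext rfl (heq_of_eq (funext fun u => Fin.ext ?_))
        exact dif_pos (show u.1.1 ≤ v.1 from u.2) }
  refine OrnamentedGraph.Iso.symm ⟨⟨ε.symm.trans e, ?_⟩, ?_⟩
  · intro x y
    obtain ⟨x, rfl⟩ := ε.surjective x
    obtain ⟨y, rfl⟩ := ε.surjective y
    simp only [Equiv.trans_apply, Equiv.symm_apply_apply]
    rw [hadj]
    exact and_congr Iff.rfl ⟨fun H u h1 h2 => H u.1 h1 h2,
      fun H u h1 h2 => H ⟨u, hc h1 x.2.1⟩ h1 h2⟩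
  · intro x
    obtain ⟨x, rfl⟩ := ε.surjective x
    refine GraphSeq.Iso.trans (horn x) ?_
    change (X.orn (e x)).Iso (X.orn (e (ε.symm (ε x))))
    rw [ε.symm_apply_apply]
    exact GraphSeq.Iso.refl _

end ColouredTree

namespace ColouredTree

variable {K : Type*} {h : ℕ}

/-! ### Finitely many coloured trees suffice -/

/-- The closure of a path is complete, so a linear order on the vertices always provides an encoding
tree. -/
theorem exists_iso_toOrnamentedGraph (X : OrnamentedGraph K h) :
    ∃ T : ColouredTree K h, T.toOrnamentedGraph.Iso X := by
  obtain ⟨n, ⟨e⟩⟩ := Finite.exists_equiv_fin X.V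
  obtain _ | n := n
  · exact (e X.nonempty.some).elim0
  · refine ⟨{ tree := { α := Fin (n + 1) }
              finite := inferInstanceAs (Finite (Fin (n + 1)))
              graph := X.graph.comap e.symm
              graph_le := fun x y hxy => (SimpleGraph.fromRel_adj _ _ _).2
                ⟨hxy.ne, le_total (α := Fin (n + 1)) x y⟩
              orn := fun x => X.orn (e.symm x) }, ⟨⟨e.symm, Iff.rfl⟩, fun v => ?_⟩⟩
    exact GraphSeq.Iso.refl _

theorem exists_iso_branch (X : OrnamentedGraph K h) :
    ∃ (T : ColouredTree K h) (k : T.tree → ℕ+), Nat.card T.tree = X.minBC ∧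
      X.Iso (T.branch k) := by
  obtain ⟨T, hTX, hbc⟩ := Nat.sInf_mem (s := {n | ∃ T : ColouredTree K h,
    T.toOrnamentedGraph.Iso X ∧ T.bc = n}) (by
      obtain ⟨T, hT⟩ := exists_iso_toOrnamentedGraph X
      exact ⟨_, T, hT, rfl⟩)
  obtain ⟨c, hcore, hcard⟩ := Nat.sInf_mem (s := {n | ∃ c, T.IsBranchingCore c ∧ c.1.ncard = n})
    (by
      obtain ⟨c, hc⟩ := exists_isBranchingCore (T := T)
      exact ⟨_, c, hc, rfl⟩)
  obtain ⟨hlower, hbot, hrep⟩ := stageInvariant_univ.reflTransGen hcore.1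
  exact ⟨T.restrict c.1 hlower hbot, fun x => c.2 x.1, hcard.trans hbc,
    hTX.symm.trans (hrep.iso_branch_restrict hlower hbot)⟩

theorem exists_iso_branch_of_orn_mem {𝓕 : Set (GraphSeq K h)} (X : OrnamentedGraph K h)
    (hX : ∀ s, X.orn s ∈ 𝓕) :
    ∃ (T : ColouredTree K h) (k : T.tree → ℕ+), Nat.card T.tree = X.minBC ∧
      (∀ s, T.orn s ∈ 𝓕) ∧ X.Iso (T.branch k) := by
  obtain ⟨T, k, hcard, hXT⟩ := exists_iso_branch X
  -- An encoding fixes ornaments only up to isomorphism. Each tree vertex has a copy, so its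
  -- ornament is isomorphic to one from `𝓕`, which then replaces it.
  have : ∀ s, ∃ F ∈ 𝓕, (T.orn s).Iso F := by
    intro s
    obtain ⟨e, he⟩ := hXT.symm
    exact ⟨_, hX _, he ⟨s, fun t => ⟨0, (k t).pos⟩⟩⟩
  choose F hF hTF using this
  refine ⟨{ T with orn := F }, k, hcard, hF, ?_⟩
  obtain ⟨e, he⟩ := hXT
  exact ⟨e, fun v => (he v).trans (hTF _)⟩

theorem branch_iso_branch {T T' : ColouredTree K h} (f : T.tree ≃o T'.tree)
    (hadj : ∀ x y, T'.graph.Adj (f x) (f y) ↔ T.graph.Adj x y)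
    (horn : ∀ x, T'.orn (f x) = T.orn x) (k : T'.tree → ℕ+) :
    (T.branch fun s => k (f s)).Iso (T'.branch k) := by
  let g : ∀ s : T.tree, Set.Iic s ≃ Set.Iic (f s) := fun s =>
    f.toEquiv.subtypeEquiv fun u => (f.le_iff_le (x := u) (y := s)).symm
  let ε : (T.branch fun s => k (f s)).V ≃ (T'.branch k).V :=
    Equiv.sigmaCongr f.toEquiv fun s =>
      Equiv.piCongrLeft (fun t : Set.Iic (f s) => Fin (k t)) (g s)
  have hε : ∀ (x : T.Copy fun s => k (f s)) (u : T.tree) (hu : u ≤ x.1) (hu' : f u ≤ f x.1),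
      ((ε x).2 ⟨f u, hu'⟩ : ℕ) = x.2 ⟨u, hu⟩ := fun x u hu hu' => congrArg Fin.val
    (Equiv.piCongrLeft_apply_apply (fun t : Set.Iic (f x.1) => Fin (k t)) (g x.1) x.2 ⟨u, hu⟩)
  refine ⟨⟨ε, fun {x y} => and_congr (hadj _ _) ?_⟩, fun v => ?_⟩
  · constructor
    · intro H u hx hy
      exact (hε x u hx _).symm.trans
        ((H (f u) (f.monotone hx) (f.monotone hy)).trans (hε y u hy _))
    · intro H u hx hy
      obtain ⟨u, rfl⟩ := f.surjective u
      have hx' : u ≤ x.1 := f.le_iff_le.1 hx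
      have hy' : u ≤ y.1 := f.le_iff_le.1 hy
      exact (hε x u hx' hx).trans ((H u hx' hy').trans (hε y u hy' hy).symm)
  · change GraphSeq.Iso (T.orn v.1) (T'.orn (f v.1))
    rw [horn]
    exact GraphSeq.Iso.refl _

/-- Isomorphism types of coloured trees with at most `N` vertices and ornaments in `𝓕`. -/
abbrev TreeCode (𝓕 : Set (GraphSeq K h)) (N : ℕ) : Type _ :=
  Σ n : Fin (N + 1), (Fin n → Fin n → Prop) × (Fin n → Fin n → Prop) × (Fin n → 𝓕)

/-- The coloured tree `T` has the isomorphism type `q`. -/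
def HasCode {𝓕 : Set (GraphSeq K h)} {N : ℕ} (T : ColouredTree K h) (q : TreeCode 𝓕 N) : Prop :=
  ∃ e : T.tree ≃ Fin q.1, (∀ x y, q.2.1 (e x) (e y) ↔ x ≤ y) ∧
    (∀ x y, q.2.2.1 (e x) (e y) ↔ T.graph.Adj x y) ∧ ∀ x, T.orn x = q.2.2.2 (e x)

theorem exists_hasCode {𝓕 : Set (GraphSeq K h)} {N : ℕ} (T : ColouredTree K h)
    (hT : Nat.card T.tree ≤ N) (horn : ∀ s, T.orn s ∈ 𝓕) : ∃ q : TreeCode 𝓕 N, T.HasCode q := by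
  let e : T.tree ≃ Fin (Nat.card T.tree) := Finite.equivFin _
  refine ⟨⟨⟨Nat.card T.tree, Nat.lt_succ_of_le hT⟩, fun x y => e.symm x ≤ e.symm y,
    fun x y => T.graph.Adj (e.symm x) (e.symm y), fun x => ⟨_, horn (e.symm x)⟩⟩, e, ?_, ?_, ?_⟩
  all_goals simp

theorem HasCode.exists_iso_branch {𝓕 : Set (GraphSeq K h)} {N : ℕ} {q : TreeCode 𝓕 N}
    {T T' : ColouredTree K h} (hT : T.HasCode q) (hT' : T'.HasCode q) (k : T.tree → ℕ+) :
    ∃ k' : T'.tree → ℕ+, (T.branch k).Iso (T'.branch k') := by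
  obtain ⟨e, hle, hadj, horn⟩ := hT
  obtain ⟨e', hle', hadj', horn'⟩ := hT'
  let f : T'.tree ≃o T.tree :=
    { toEquiv := e'.trans e.symm
      map_rel_iff' := fun {x y} => by
        rw [← hle, ← hle']
        simp }
  refine ⟨fun s => k (f s), OrnamentedGraph.Iso.symm (branch_iso_branch f (fun x y => ?_)
    (fun x => ?_) k)⟩
  · rw [← hadj, ← hadj']
    simp [f]
  · rw [horn, horn']
    simp [f]

/-- A choice function for non-empty sets. -/
theorem _root_.exists_set_choice (α : Type*) [Nonempty α] :
    ∃ g : Set α → α, ∀ s : Set α, s.Nonempty → g s ∈ s := by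
  classical
  refine ⟨fun s => if hs : s.Nonempty then hs.some else Classical.arbitrary α, fun s hs => ?_⟩
  dsimp only
  rw [dif_pos hs]
  exact hs.some_mem

/-- Finitely many coloured trees suffice for ornamented graphs of bounded minimum branching core
size. -/
theorem exists_finite_trees {𝓕 : Set (GraphSeq K h)} (h𝓕 : 𝓕.Finite) (N : ℕ) :
    ∃ (ι : Type) (_ : Finite ι) (T : ι → ColouredTree K h), (∀ i s, (T i).orn s ∈ 𝓕) ∧
      ∀ X : OrnamentedGraph K h, (∀ s, X.orn s ∈ 𝓕) → X.minBC ≤ N →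
        ∃ i k, X.Iso ((T i).branch k) := by
  have := h𝓕.to_subtype
  -- Only codes realised by some tree are kept; passing to `Fin n` then puts the index set in
  -- `Type`.
  let Q := {q : TreeCode 𝓕 N // ∃ T : ColouredTree K h, T.HasCode q}
  obtain ⟨n, ⟨e⟩⟩ := Finite.exists_equiv_fin Q
  choose T hT using fun i => (e.symm i).2
  refine ⟨Fin n, inferInstance, T, fun i s => ?_, fun X hX hN => ?_⟩
  · obtain ⟨e, -, -, horn⟩ := hT i
    rw [horn]
    exact Subtype.coe_prop _
  · obtain ⟨T', k, hcard, horn, hXT⟩ := exists_iso_branch_of_orn_mem X hX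
    obtain ⟨q, hq⟩ := T'.exists_hasCode (hcard.trans_le hN) horn
    obtain ⟨k', hk'⟩ := hq.exists_iso_branch
      (T' := T (e ⟨q, T', hq⟩)) (by simpa using hT (e ⟨q, T', hq⟩)) k
    exact ⟨_, k', hXT.trans hk'⟩

end ColouredTree

/-! ### ### The partition and its indexing -/

theorem mainTheorem3 {K : Type*} [Field K] [CharZero K] (h : ℕ)
    (𝓕 : Set (GraphSeq K h)) (h𝓕 : 𝓕.Finite)
    (hpoly : ∀ F ∈ 𝓕, IsStronglyPolynomial F)
    (𝓗 : Set (OrnamentedGraph K h))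
    (horn : ∀ X ∈ 𝓗, ∀ s : X.V, X.orn s ∈ 𝓕)
    (hbc : BddAbove (OrnamentedGraph.minBC '' 𝓗)) :
    ∃ (m : ℕ) (P : Fin m → Set (OrnamentedGraph K h)),
      -- a partition of the family, compatible with isomorphism
      (∀ l, (P l).Nonempty) ∧ (⋃ l, P l) = 𝓗 ∧
      (∀ l l', ∀ X ∈ P l, ∀ Y ∈ P l', X.Iso Y → l = l') ∧
      ∃ (T : Fin m → ColouredTree K h) (I : ∀ l, Set ((T l).tree → ℕ+)),
        ∀ l,
          (∀ s, (T l).orn s ∈ 𝓕) ∧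
          -- the part is indexed by `I l`, through branching of the fixed coloured tree `T l`
          (∀ X ∈ P l, ∃! k, k ∈ I l ∧ X.Iso ((T l).branch k)) ∧
          (∀ k ∈ I l, ∃ X ∈ P l, X.Iso ((T l).branch k)) ∧
          (∀ X ∈ P l, ∀ k ∈ I l, X.Iso ((T l).branch k) →
            ∀ j, (X.comp j).Iso (((T l).branch k).comp j)) ∧
          -- strongly polynomial subsequence in the branching and ornament indices jointly
          IsStronglyPolynomialSubseq (σ := (T l).tree ⊕ Fin h)
            {x | (fun s => x (Sum.inl s)) ∈ I l}
            (fun x => ((T l).branch fun s => x (Sum.inl s)).comp fun i => x (Sum.inr i)) ∧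
          -- strongly polynomial subsequence in the branching indices for each fixed `j`
          (∀ j, IsStronglyPolynomialSubseq (I l) (fun k => ((T l).branch k).comp j)) := by
  obtain ⟨N, hN⟩ := hbc
  obtain ⟨ι, _, T, hT, hX⟩ := ColouredTree.exists_finite_trees h𝓕 N
  have hcover : ∀ X ∈ 𝓗, {i | ∃ k, X.Iso ((T i).branch k)}.Nonempty := fun X hXH =>
    hX X (horn X hXH) (hN ⟨X, hXH, rfl⟩)
  have hcongr : ∀ X Y : OrnamentedGraph K h, X.Iso Y → ∀ Z, X.Iso Z ↔ Y.Iso Z :=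
    fun X Y hXY Z => ⟨fun hXZ => hXY.symm.trans hXZ, fun hYZ => hXY.trans hYZ⟩
  -- the part of `X` depends only on its isomorphism type
  obtain ⟨part, hpart, hpart_congr⟩ : ∃ part : 𝓗 → ι,
      (∀ X : 𝓗, ∃ k, X.1.Iso ((T (part X)).branch k)) ∧ ∀ X Y : 𝓗, X.1.Iso Y.1 → part X = part Y := by
    obtain hempty | ⟨⟨X₀, hX₀⟩⟩ := isEmpty_or_nonempty 𝓗
    · exact ⟨fun X => isEmptyElim X, fun X => isEmptyElim X, fun X => isEmptyElim X⟩
    have : Nonempty ι := ⟨(hcover X₀ hX₀).some⟩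
    -- The choice is a function of the set of admissible trees; isomorphic graphs have the same set,
    -- hence the same part.
    obtain ⟨g, hg⟩ := exists_set_choice ι
    refine ⟨fun X => g {i | ∃ k, X.1.Iso ((T i).branch k)}, fun X => hg _ (hcover _ X.2),
      fun X Y hXY => ?_⟩
    simp only [hcongr _ _ hXY]
  -- so does its index within the part
  choose g hg using fun i => exists_set_choice ((T i).tree → ℕ+)
  let index : ∀ i, OrnamentedGraph K h → ((T i).tree → ℕ+) :=
    fun i X => g i {k | X.Iso ((T i).branch k)}
  have hindex : ∀ X : 𝓗, X.1.Iso ((T (part X)).branch (index (part X) X.1)) := fun X =>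
    hg _ _ (hpart X)
  have hindex_congr : ∀ i (X Y : OrnamentedGraph K h), X.Iso Y → index i X = index i Y :=
    fun i X Y hXY => by simp only [index, hcongr _ _ hXY]
  obtain ⟨m, ⟨e⟩⟩ := Finite.exists_equiv_fin (Set.range part)
  let P : Fin m → Set (OrnamentedGraph K h) := fun l =>
    {X | ∃ hX : X ∈ 𝓗, part ⟨X, hX⟩ = (e.symm l).1}
  have hP : ∀ l, ∀ X ∈ P l, X.Iso ((T (e.symm l)).branch (index (e.symm l) X)) := by
    rintro l X ⟨hXH, hl⟩
    rw [← hl]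
    exact hindex ⟨X, hXH⟩
  refine ⟨m, P, fun l => ?_, ?_, ?_, fun l => T (e.symm l),
    fun l => index (e.symm l) '' P l, fun l => ⟨hT _, ?_, ?_, ?_, ?_, ?_⟩⟩
  · obtain ⟨X, hX⟩ := (e.symm l).2
    exact ⟨X.1, X.2, hX⟩
  · ext X
    simp only [Set.mem_iUnion]
    exact ⟨fun ⟨l, hX, _⟩ => hX, fun hX => ⟨e ⟨_, ⟨X, hX⟩, rfl⟩, hX, by simp⟩⟩
  · rintro l l' X ⟨hX, hl⟩ Y ⟨hY, hl'⟩ hXY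
    exact e.symm.injective (Subtype.ext (hl ▸ hl' ▸ hpart_congr ⟨X, hX⟩ ⟨Y, hY⟩ hXY))
  · intro X hX
    refine ⟨index (e.symm l) X, ⟨⟨X, hX, rfl⟩, hP l X hX⟩, ?_⟩
    -- Different `k` may give isomorphic branchings, but `I l` holds only chosen indices: sharing a
    -- branching makes `X` and `Y` isomorphic, so their indices agree.
    rintro _ ⟨⟨Y, hY, rfl⟩, hXY⟩
    exact hindex_congr _ _ _ ((hP l Y hY).trans hXY.symm)
  · rintro _ ⟨X, hX, rfl⟩
    exact ⟨X, hX, hP l X hX⟩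
  · exact fun X _ k _ hXk j => hXk.comp j
  · exact ⟨_, ColouredTree.isStronglyPolynomial_comp_branch _ fun s => hpoly _ (hT _ s),
      fun k _ => WGraph.Iso.refl _⟩
  · exact fun j => ⟨_, ColouredTree.isStronglyPolynomial_comp_branch_fixed _
      (fun s => hpoly _ (hT _ s)) j, fun k _ => WGraph.Iso.refl _⟩
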